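/- Let $\mathbb{k}$ be a field, $\delta\in\mathbb{k}$ and $n\ge 0$. For $a,b\ge 0$ let $\mathrm{Hom}(a,b)$ be the $\mathbb{k}$-vector space with basis the $(a,b)$-diagrams, i.e. the planar pairings of $a$ bottom sites and $b$ top sites. Composition $x\circ y$ is vertical concatenation ($y$ below $x$), each closed loop being replaced by a factor $\delta$, and $x\mapsto x^*$ is the linear extension of the reflection of diagrams across the horizontal axis. The through degree of a diagram is the number of its lines that join a bottom site to a top site. Let $\mathsf{TL}_n=\mathsf{TL}_n^{\mathbb{k}}(\delta)=\mathrm{Hom}(n,n)$ be the Temperley--Lieb algebra, and let $\mathbf{td}(<m)\subseteq\mathsf{TL}_n$ be the span of the $(n,n)$-diagrams of through degree less than $m$. For $0\le m\le n$ with $m\equiv n \pmod 2$, the cell module $\Delta_n(m)$ is the quotient of $\mathrm{Hom}(m,n)$ by the span of the diagrams of through degree less than $m$, with $\mathsf{TL}_n$ acting by composition. It carries the bilinear form $\langle x,y\rangle$ given by the coefficient of the identity diagram $\mathrm{id}_m$ in $x^*\circ y$. Let $\Lambda_0$ be the set of those $m$ ($0\le m\le n$, $m\equiv n \pmod 2$)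 for which this form is not identically zero, that is, for which its radical is not all of $\Delta_n(m)$. Let $y_m\in\mathrm{Hom}(m,n)$ be the diagram whose top row consists, from left to right, of $(n-m)/2$ cups joining neighbouring sites, followed by $m$ propagating lines. For $m\neq 0$ let $z_m\in\mathrm{Hom}(m,n)$ be the diagram whose top row consists, from left to right, of one propagating line, $(n-m)/2$ cups joining neighbouring sites, and $m-1$ propagating lines. Write $y_mz_m^*\in\mathsf{TL}_n$ for the composite $y_m\circ z_m^*$ if $m\ne 0$, and for $\delta^{-n/2}\,y_0\circ y_0^*$ if $m=0$ (this is $\mathrm{id}_0$ if $n=m=0$, whatever $\delta$ is; if $n>0$ and $0\in\Lambda_0$, then $\delta\ne 0$). Proposition. Let $m\in\Lambda_0$ and let $M$ be any $\mathsf{TL}_n$-module. Then $\phi\mapsto\phi(y_m)$, where $y_m$ denotes also its class in $\Delta_n(m)$, is an isomorphism of $\mathbb{k}$-vector spaces $$\mathrm{Hom}_{\mathsf{TL}_n}(\Delta_n(m),M)\;\cong\;\{v\in M \mid \mathbf{td}(<m)\cdot v=0\ \text{ and }\ y_mz_m^*\,v=v\}.$$ -/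

import Mathlib

namespace TemperleyLieb

set_option linter.unusedSectionVars false
set_option linter.unusedVariables false

/-! ### Gluing sites of a pairing

A pairing of a set `T` of sites is a fixed-point-free involution `f : T → T`; the line through a
site `x` has `x` and `f x` as its end points. -/

section Gluing

variable {T T' : Type*} [DecidableEq T] [DecidableEq T']

/-- Glue the sites `a` and `b` of the pairing `f`: the lines `a — f a` and `b — f b` are joined to
one line `f a — f b`. The sites `a`, `b` are used up by this; they are kept as a dummy pair, so that
the set of sites does not change. If `f a = b`, then gluing closes a loop, and nothing changes. -/
def glue (f : T → T) (a b : T) : T → T := fun x =>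
  if x = a then b else if x = b then a else
    if f x = a then f b else if f x = b then f a else f x

/-- Glue all pairs of sites in a list, one after the other. -/
def glueAll : List (T × T) → (T → T) → T → T
  | [], f => f
  | ab :: l, f => glueAll l (glue f ab.1 ab.2)

/-- `1` if `x = y`, and `0` otherwise. -/
def ind (x y : T) : ℕ := if x = y then 1 else 0

/-- The number of loops that are closed while the pairs in the list are glued one by one. -/
def glueLoops : List (T × T) → (T → T) → ℕ
  | [], _ => 0
  | ab :: l, f => ind (f ab.1) ab.2 + glueLoops l (glue f ab.1 ab.2)

/-- A pairing: a fixed-point-free involution. -/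
structure IsPairing (f : T → T) : Prop where
  invol : ∀ x, f (f x) = x
  ne : ∀ x, f x ≠ x

theorem IsPairing.glue {f : T → T} (hf : IsPairing f) {a b : T} (hab : a ≠ b) :
    IsPairing (glue f a b) := by
  have h1 := hf.invol
  have h2 := hf.ne
  constructor
  · intro x; simp only [TemperleyLieb.glue]; grind
  · intro x; simp only [TemperleyLieb.glue]; grind

theorem IsPairing.glueAll {l : List (T × T)} {f : T → T} (hf : IsPairing f)
    (hl : ∀ ab ∈ l, ab.1 ≠ ab.2) : IsPairing (glueAll l f) := by
  induction l generalizing f with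
  | nil => exact hf
  | cons ab l ih =>
    exact ih (hf.glue (hl ab (by simp))) fun cd h => hl cd (by simp [h])

theorem glue_comm {f : T → T} (hf : IsPairing f) {a b c d : T} (hab : a ≠ b) (hcd : c ≠ d)
    (hac : a ≠ c) (had : a ≠ d) (hbc : b ≠ c) (hbd : b ≠ d) :
    glue (glue f a b) c d = glue (glue f c d) a b := by
  have h1 := hf.invol
  have h2 := hf.ne
  funext x
  simp only [glue]
  grind (splits := 20)

theorem glue_loops_comm {f : T → T} (hf : IsPairing f) {a b c d : T} (hab : a ≠ b) (hcd : c ≠ d)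
    (hac : a ≠ c) (had : a ≠ d) (hbc : b ≠ c) (hbd : b ≠ d) :
    ind (f a) b + ind (glue f a b c) d =
      ind (f c) d + ind (glue f c d a) b := by
  have h1 := hf.invol
  have h2 := hf.ne
  simp only [glue, ind]
  grind (splits := 20)

/-- Two pairs of sites with four different members. -/
def Apart (p q : T × T) : Prop :=
  p.1 ≠ q.1 ∧ p.1 ≠ q.2 ∧ p.2 ≠ q.1 ∧ p.2 ≠ q.2

theorem glueAll_glue_comm {l : List (T × T)} {f : T → T} (hf : IsPairing f) {c : T × T}
    (hl : ∀ ab ∈ l, ab.1 ≠ ab.2) (hc : c.1 ≠ c.2) (h : ∀ ab ∈ l, Apart ab c) :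
    glueAll l (glue f c.1 c.2) = glue (glueAll l f) c.1 c.2 ∧
    ind (f c.1) c.2 + glueLoops l (glue f c.1 c.2) =
      glueLoops l f + ind (glueAll l f c.1) c.2 := by
  induction l generalizing f with
  | nil => simp [glueAll, glueLoops]
  | cons ab l ih =>
    obtain ⟨h1, h2, h3, h4⟩ := h ab (by simp)
    have hab := hl ab (by simp)
    have := ih (hf.glue hab) (fun x hx => hl x (by simp [hx])) (fun x hx => h x (by simp [hx]))
    have e := glue_comm hf hab hc h1 h2 h3 h4
    have e' := glue_loops_comm hf hab hc h1 h2 h3 h4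
    simp only [glueAll, glueLoops]
    rw [← e]
    refine ⟨this.1, ?_⟩
    have := this.2
    omega

theorem glueAll_comm {l l' : List (T × T)} {f : T → T} (hf : IsPairing f)
    (hl : ∀ ab ∈ l, ab.1 ≠ ab.2) (hl' : ∀ ab ∈ l', ab.1 ≠ ab.2)
    (h : ∀ ab ∈ l, ∀ cd ∈ l', Apart ab cd) :
    glueAll l (glueAll l' f) = glueAll l' (glueAll l f) ∧
    glueLoops l' f + glueLoops l (glueAll l' f) =
      glueLoops l f + glueLoops l' (glueAll l f) := by
  induction l' generalizing f with
  | nil => simp [glueAll, glueLoops]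
  | cons cd l' ih =>
    have hcd := hl' cd (by simp)
    have := ih (hf.glue hcd) (fun x hx => hl' x (by simp [hx]))
      (fun x hx y hy => h x hx y (by simp [hy]))
    have e := glueAll_glue_comm hf hl hcd (fun x hx => h x hx cd (by simp))
    simp only [glueAll, glueLoops]
    rw [e.1] at this
    refine ⟨this.1, ?_⟩
    have := this.2
    have := e.2
    omega

theorem ind_map {j : T → T'} (hj : Function.Injective j) (x y : T) : ind (j x) (j y) = ind x y := by
  simp only [ind, hj.eq_iff]

theorem glue_map {j : T → T'} (hj : Function.Injective j) {f : T → T} {f' : T' → T'}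
    (h : ∀ x, f' (j x) = j (f x)) (a b x : T) :
    glue f' (j a) (j b) (j x) = j (glue f a b x) := by
  simp only [glue, h, hj.eq_iff]
  split_ifs <;> rfl

theorem glueAll_map {j : T → T'} (hj : Function.Injective j) {f : T → T} {f' : T' → T'}
    (h : ∀ x, f' (j x) = j (f x)) (l : List (T × T)) :
    (∀ x, glueAll (l.map (Prod.map j j)) f' (j x) = j (glueAll l f x)) ∧
    glueLoops (l.map (Prod.map j j)) f' = glueLoops l f := by
  induction l generalizing f f' with
  | nil => exact ⟨h, rfl⟩
  | cons ab l ih =>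
    have := ih (glue_map hj h ab.1 ab.2)
    simp only [List.map_cons, glueAll, glueLoops, Prod.map_fst, Prod.map_snd, h, ind_map hj]
    exact ⟨this.1, by rw [this.2]⟩

theorem glue_inl (f : T → T) (g : T' → T') (a b : T) :
    glue (Sum.map f g) (Sum.inl a) (Sum.inl b) = Sum.map (glue f a b) g := by
  funext x
  cases x <;> simp [glue]
  split_ifs <;> rfl

theorem glue_inr (f : T → T) (g : T' → T') (a b : T') :
    glue (Sum.map f g) (Sum.inr a) (Sum.inr b) = Sum.map f (glue g a b) := by
  funext x
  cases x <;> simp [glue]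
  split_ifs <;> rfl

theorem glueAll_inl (f : T → T) (g : T' → T') (l : List (T × T)) :
    glueAll (l.map (Prod.map Sum.inl Sum.inl)) (Sum.map f g) = Sum.map (glueAll l f) g ∧
    glueLoops (l.map (Prod.map Sum.inl Sum.inl)) (Sum.map f g) = glueLoops l f := by
  induction l generalizing f with
  | nil => exact ⟨rfl, rfl⟩
  | cons ab l ih =>
    simp only [List.map_cons, glueAll, glueLoops, Prod.map_fst, Prod.map_snd, glue_inl, ih,
      Sum.map_inl, ind_map Sum.inl_injective, and_self]

theorem glueAll_inr (f : T → T) (g : T' → T') (l : List (T' × T')) :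
    glueAll (l.map (Prod.map Sum.inr Sum.inr)) (Sum.map f g) = Sum.map f (glueAll l g) ∧
    glueLoops (l.map (Prod.map Sum.inr Sum.inr)) (Sum.map f g) = glueLoops l g := by
  induction l generalizing g with
  | nil => exact ⟨rfl, rfl⟩
  | cons ab l ih =>
    simp only [List.map_cons, glueAll, glueLoops, Prod.map_fst, Prod.map_snd, glue_inr, ih,
      Sum.map_inr, ind_map Sum.inr_injective, and_self]

theorem IsPairing.sumMap {f : T → T} {g : T' → T'} (hf : IsPairing f) (hg : IsPairing g) :
    IsPairing (Sum.map f g) := by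
  constructor
  · rintro (x | x) <;> simp [hf.invol, hg.invol]
  · rintro (x | x) <;> simp [hf.ne, hg.ne]

theorem glue_swap {a b : T} (hab : a ≠ b) (f : T → T) : glue f a b = glue f b a := by
  funext x
  simp only [glue]
  grind

theorem glueAll_swap {l : List (T × T)} {f : T → T} (hf : IsPairing f)
    (hl : ∀ ab ∈ l, ab.1 ≠ ab.2) :
    glueAll (l.map Prod.swap) f = glueAll l f ∧
    glueLoops (l.map Prod.swap) f = glueLoops l f := by
  induction l generalizing f with
  | nil => exact ⟨rfl, rfl⟩
  | cons ab l ih =>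
    have hab := hl ab (by simp)
    have := ih (hf.glue hab) (fun x hx => hl x (by simp [hx]))
    have h1 := hf.invol
    have hi : ind (f ab.2) ab.1 = ind (f ab.1) ab.2 := by
      simp only [ind]
      grind
    simp only [List.map_cons, glueAll, glueLoops, Prod.fst_swap, Prod.snd_swap]
    rw [glue_swap hab.symm, hi]
    exact ⟨this.1, by rw [this.2]⟩

end Gluing

/-! ### Vertical concatenation of pairings -/

section Concat

variable {A B C D : Type*} [DecidableEq A] [DecidableEq B] [DecidableEq C] [DecidableEq D]

/-- The two copies of each site in the middle row, when a pairing of `A ⊕ B` is put below a pairing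
of `B ⊕ C`. -/
def middle (A C : Type*) (l : List B) : List (((A ⊕ B) ⊕ (B ⊕ C)) × ((A ⊕ B) ⊕ (B ⊕ C))) :=
  l.map fun i => (Sum.inl (Sum.inr i), Sum.inr (Sum.inl i))

/-- The inclusion of the outer rows. -/
def outer (B : Type*) (x : A ⊕ C) : (A ⊕ B) ⊕ (B ⊕ C) := Sum.map Sum.inl Sum.inr x

/-- Vertical concatenation of the pairing `f` (below) and the pairing `g` (above), where `l` lists
the sites of the middle row: glue the two copies of every middle site, and keep the lines on the
outer rows. The last case in the match never occurs. -/
def concat (l : List B) (g : B ⊕ C → B ⊕ C) (f : A ⊕ B → A ⊕ B) : A ⊕ C → A ⊕ C := fun x =>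
  match glueAll (middle A C l) (Sum.map f g) (outer B x) with
  | Sum.inl (Sum.inl a) => Sum.inl a
  | Sum.inr (Sum.inr c) => Sum.inr c
  | _ => x

/-- The number of closed loops that arise in the vertical concatenation. -/
def concatLoops (l : List B) (g : B ⊕ C → B ⊕ C) (f : A ⊕ B → A ⊕ B) : ℕ :=
  glueLoops (middle A C l) (Sum.map f g)

theorem outer_injective : Function.Injective (outer B : A ⊕ C → _) := by
  rintro (x | x) (y | y) h <;> simp_all [outer]

theorem middle_ne (l : List B) : ∀ ab ∈ middle A C l, ab.1 ≠ ab.2 := by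
  intro ab h
  simp only [middle, List.mem_map] at h
  obtain ⟨i, _, rfl⟩ := h
  simp

theorem glueAll_middle_of_eq (l : List B) {f : (A ⊕ B) ⊕ (B ⊕ C) → (A ⊕ B) ⊕ (B ⊕ C)} {i : B}
    (h : f (Sum.inl (Sum.inr i)) = Sum.inr (Sum.inl i)) :
    glueAll (middle A C l) f (Sum.inl (Sum.inr i)) = Sum.inr (Sum.inl i) := by
  induction l generalizing f with
  | nil => exact h
  | cons j l ih =>
    apply ih
    by_cases hij : i = j
    · subst hij; simp [glue]
    · simp [glue, h, hij]

theorem glueAll_middle (l : List B) (f : (A ⊕ B) ⊕ (B ⊕ C) → (A ⊕ B) ⊕ (B ⊕ C)) {i : B}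
    (hi : i ∈ l) :
    glueAll (middle A C l) f (Sum.inl (Sum.inr i)) = Sum.inr (Sum.inl i) := by
  induction l generalizing f with
  | nil => simp at hi
  | cons j l ih =>
    rcases List.mem_cons.1 hi with rfl | h
    · exact glueAll_middle_of_eq l (by simp [glue])
    · exact ih _ h

theorem outer_concat {l : List B} (hl : ∀ i, i ∈ l) {g : B ⊕ C → B ⊕ C} {f : A ⊕ B → A ⊕ B}
    (hg : IsPairing g) (hf : IsPairing f) (x : A ⊕ C) :
    glueAll (middle A C l) (Sum.map f g) (outer B x) = outer B (concat l g f x) := by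
  have hp : IsPairing (glueAll (middle A C l) (Sum.map f g)) :=
    (hf.sumMap hg).glueAll (middle_ne l)
  rcases h : glueAll (middle A C l) (Sum.map f g) (outer B x) with (a | b) | (b | c)
  · simp only [concat, h]; rfl
  · exfalso
    have := hp.invol (outer B x)
    rw [h, glueAll_middle l _ (hl b)] at this
    cases x <;> simp [outer] at this
  · exfalso
    have := hp.invol (outer B x)
    have h2 := hp.invol (Sum.inl (Sum.inr b))
    rw [glueAll_middle l _ (hl b)] at h2
    rw [h, h2] at this
    cases x <;> simp [outer] at this
  · simp only [concat, h]; rfl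

theorem IsPairing.concat {l : List B} (hl : ∀ i, i ∈ l) {g : B ⊕ C → B ⊕ C} {f : A ⊕ B → A ⊕ B}
    (hg : IsPairing g) (hf : IsPairing f) : IsPairing (concat l g f) := by
  have hp : IsPairing (TemperleyLieb.glueAll (middle A C l) (Sum.map f g)) :=
    (hf.sumMap hg).glueAll (middle_ne l)
  constructor
  · intro x
    apply outer_injective (B := B)
    rw [← outer_concat hl hg hf, ← outer_concat hl hg hf, hp.invol]
  · intro x h
    apply hp.ne (outer B x)
    rw [outer_concat hl hg hf, h]

theorem concat_assoc {l : List B} (hl : ∀ i, i ∈ l) {l' : List C} (hl' : ∀ i, i ∈ l')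
    {f : A ⊕ B → A ⊕ B} {g : B ⊕ C → B ⊕ C} {h : C ⊕ D → C ⊕ D}
    (hf : IsPairing f) (hg : IsPairing g) (hh : IsPairing h) :
    concat l' h (concat l g f) = concat l (concat l' h g) f ∧
    concatLoops l g f + concatLoops l' h (concat l g f) =
      concatLoops l' h g + concatLoops l (concat l' h g) f := by
  -- everything happens in one big set of sites, in which the two middle rows are glued
  -- in either order
  let σ : ((A ⊕ B) ⊕ (B ⊕ C)) ⊕ (C ⊕ D) → (A ⊕ B) ⊕ ((B ⊕ C) ⊕ (C ⊕ D)) :=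
    Equiv.sumAssoc _ _ _
  have hσ : Function.Injective σ := (Equiv.sumAssoc _ _ _).injective
  let F := Sum.map (Sum.map f g) h
  let F' := Sum.map f (Sum.map g h)
  have hF : IsPairing F' := hf.sumMap (hg.sumMap hh)
  have hσF : ∀ x, F' (σ x) = σ (F x) := by rintro ((x | x) | x) <;> rfl
  let m1 := (middle A C l).map
    (Prod.map (Sum.inl (β := C ⊕ D)) (Sum.inl (β := C ⊕ D)))
  let m2 := (middle B D l').map
    (Prod.map (Sum.inr (α := A ⊕ B)) (Sum.inr (α := A ⊕ B)))
  let k1 : (A ⊕ C) ⊕ (C ⊕ D) → ((A ⊕ B) ⊕ (B ⊕ C)) ⊕ (C ⊕ D) := Sum.map (outer B) id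
  let k2 : (A ⊕ B) ⊕ (B ⊕ D) → (A ⊕ B) ⊕ ((B ⊕ C) ⊕ (C ⊕ D)) := Sum.map id (outer C)
  have hk1 : Function.Injective k1 := Sum.map_injective.2 ⟨outer_injective, fun _ _ h => h⟩
  have hk2 : Function.Injective k2 := Sum.map_injective.2 ⟨fun _ _ h => h, outer_injective⟩
  have E1 := glueAll_inl (Sum.map f g) h (middle A C l)
  have E2 := glueAll_inr f (Sum.map g h) (middle B D l')
  have G1 := glueAll_map hk1 (f := Sum.map (concat l g f) h)
    (f' := Sum.map (glueAll (middle A C l) (Sum.map f g)) h)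
    (by rintro (x | x)
        · simp [k1, outer_concat hl hg hf]
        · rfl) (middle A D l')
  have G2 := glueAll_map hk2 (f := Sum.map f (concat l' h g))
    (f' := Sum.map f (glueAll (middle B D l') (Sum.map g h)))
    (by rintro (x | x)
        · rfl
        · simp [k2, outer_concat hl' hh hg]) (middle A D l)
  have e1 : m1.map (Prod.map σ σ) = (middle A D l).map (Prod.map k2 k2) := by
    simp only [m1, middle, List.map_map]; rfl
  have e2 : ((middle A D l').map (Prod.map k1 k1)).map (Prod.map σ σ) = m2 := by
    simp only [m2, middle, List.map_map]; rfl
  have S1 := glueAll_map hσ hσF m1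
  have S2 := glueAll_map hσ S1.1 ((middle A D l').map (Prod.map k1 k1))
  rw [e1] at S1
  rw [e1, e2] at S2
  have n1 : ∀ ab ∈ (middle A D l).map (Prod.map k2 k2), ab.1 ≠ ab.2 := by
    simp [middle, k2, outer]
  have n2 : ∀ ab ∈ m2, ab.1 ≠ ab.2 := by simp [m2, middle]
  have ap : ∀ ab ∈ (middle A D l).map (Prod.map k2 k2), ∀ cd ∈ m2, Apart ab cd := by
    simp [m2, middle, k2, outer, Apart]
  have K := glueAll_comm hF n1 n2 ap
  rw [← K.1] at S2
  constructor
  · funext x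
    apply hk2.comp outer_injective
    have a1 := S2.1 (k1 (outer C x))
    rw [E1.1, G1.1, outer_concat hl' hh (IsPairing.concat hl hg hf)] at a1
    have a2 := G2.1 (outer B x)
    rw [outer_concat hl (IsPairing.concat hl' hh hg) hf, ← E2.1] at a2
    have b : ∀ y : A ⊕ D, σ (k1 (outer C y)) = k2 (outer B y) := by rintro (y | y) <;> rfl
    rw [b, b] at a1
    exact a1.symm.trans a2
  · have L1 := G1.2
    have L2 := G2.2
    rw [← E2.1] at L2
    rw [← E1.1] at L1
    have := K.2
    have := S1.2
    have := S2.2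
    have := E1.2
    have := E2.2
    simp only [concatLoops]
    grind

/-- Vertical reflection of a pairing. -/
def reflect (f : A ⊕ B → A ⊕ B) : B ⊕ A → B ⊕ A := fun x => (f x.swap).swap

theorem IsPairing.reflect {f : A ⊕ B → A ⊕ B} (hf : IsPairing f) : IsPairing (reflect f) := by
  constructor
  · intro x; simp [TemperleyLieb.reflect, hf.invol]
  · intro x h
    apply hf.ne x.swap
    have := congrArg Sum.swap h
    simpa [TemperleyLieb.reflect] using this

theorem concat_reflect {l : List B} (hl : ∀ i, i ∈ l) {g : B ⊕ C → B ⊕ C} {f : A ⊕ B → A ⊕ B}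
    (hg : IsPairing g) (hf : IsPairing f) :
    concat l (reflect f) (reflect g) = reflect (concat l g f) ∧
    concatLoops l (reflect f) (reflect g) = concatLoops l g f := by
  let j : (A ⊕ B) ⊕ (B ⊕ C) → (C ⊕ B) ⊕ (B ⊕ A) := fun x => (Sum.map Sum.swap Sum.swap x).swap
  have hj : Function.Injective j := by
    rintro ((x | x) | (x | x)) ((y | y) | (y | y)) h <;> simp_all [j]
  have hF : ∀ x, Sum.map (reflect g) (reflect f) (j x) = j (Sum.map f g x) := by
    rintro (x | x) <;> simp [j, reflect]
  have e : (middle A C l).map (Prod.map j j) = (middle C A l).map Prod.swap := by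
    simp only [middle, List.map_map]; rfl
  have S := glueAll_map hj hF (middle A C l)
  have W := glueAll_swap (hg.reflect.sumMap hf.reflect) (middle_ne (A := C) (C := A) l)
  rw [e] at S
  rw [W.1, W.2] at S
  refine ⟨?_, S.2⟩
  funext x
  apply outer_injective (B := B)
  have := S.1 (outer B x.swap)
  rw [outer_concat hl hg hf] at this
  have b : ∀ y : A ⊕ C, j (outer B y) = outer B y.swap := by rintro (y | y) <;> rfl
  rw [b, b, Sum.swap_swap, outer_concat hl hf.reflect hg.reflect] at this
  exact this

theorem glueAll_swap_left (l : List B) (hl : l.Nodup) {g : B ⊕ C → B ⊕ C} (hg : IsPairing g)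
    {f : (B ⊕ B) ⊕ (B ⊕ C) → (B ⊕ B) ⊕ (B ⊕ C)} (hf : IsPairing f)
    {q : B ⊕ C → (B ⊕ B) ⊕ (B ⊕ C)}
    (hq : q = Sum.elim (fun i => if i ∈ l then Sum.inr (Sum.inl i) else Sum.inl (Sum.inl i))
      (fun c => Sum.inr (Sum.inr c)))
    (hfq : ∀ x, f (q x) = q (g x))
    (hfl : ∀ i ∈ l, f (Sum.inl (Sum.inr i)) = Sum.inl (Sum.inl i)) :
    (∀ x, glueAll (middle B C l) f (outer B x) = outer B (g x)) ∧
      glueLoops (middle B C l) f = 0 := by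
  induction l generalizing f q with
  | nil =>
    have : q = outer B := by
      subst hq; funext x; cases x <;> simp [outer]
    subst this
    exact ⟨hfq, rfl⟩
  | cons j l ih =>
    obtain ⟨hj, hl⟩ := List.nodup_cons.1 hl
    have hfj := hfl j (by simp)
    have hfj' : f (Sum.inl (Sum.inl j)) = Sum.inl (Sum.inr j) := by rw [← hfj, hf.invol]
    have qj : q (Sum.inl j) = Sum.inr (Sum.inl j) := by simp [hq]
    let q' : B ⊕ C → (B ⊕ B) ⊕ (B ⊕ C) :=
      Sum.elim (fun i => if i ∈ l then Sum.inr (Sum.inl i) else Sum.inl (Sum.inl i))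
        (fun c => Sum.inr (Sum.inr c))
    have q'j : q' (Sum.inl j) = Sum.inl (Sum.inl j) := by simp [q', hj]
    have qq : ∀ x, x ≠ Sum.inl j → q' x = q x := by
      rintro (i | c) hx
      · have : i ≠ j := fun h => hx (by rw [h])
        simp [q', hq, this]
      · simp [q', hq]
    have qa : ∀ x, q x ≠ Sum.inl (Sum.inr j) := by
      rintro (i | c)
      · simp only [hq, Sum.elim_inl]; split_ifs <;> simp
      · simp [hq]
    have qi : ∀ x, q x = Sum.inr (Sum.inl j) → x = Sum.inl j := by
      rintro (i | c)
      · simp only [hq, Sum.elim_inl]; split_ifs <;> simp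
      · simp [hq]
    have := ih hl (hf.glue (a := Sum.inl (Sum.inr j)) (b := Sum.inr (Sum.inl j)) (by simp))
      (q := q') rfl ?_ ?_
    · simp only [middle, List.map_cons, glueAll, glueLoops] at this ⊢
      refine ⟨this.1, ?_⟩
      rw [this.2, hfj]
      simp [ind]
    · intro x
      by_cases hx : x = Sum.inl j
      · subst hx
        rw [q'j, qq _ (hg.ne _), ← hfq, qj]
        simp [glue, hfj']
      · rw [qq x hx]
        simp only [glue, hfq]
        rw [if_neg (qa x), if_neg (fun h => hx (qi x h)), if_neg (qa _)]
        by_cases hgx : g x = Sum.inl j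
        · rw [hgx, q'j, qj, if_pos rfl, hfj]
        · rw [if_neg (fun h => hgx (qi _ h)), qq _ hgx]
    · intro i hi
      have : i ≠ j := fun h => hj (h ▸ hi)
      simp [glue, this, hfl i (by simp [hi])]

theorem isPairing_swap : IsPairing (Sum.swap : B ⊕ B → B ⊕ B) := by
  constructor
  · simp
  · rintro (x | x) <;> simp

theorem concat_swap {l : List B} (hl : ∀ i, i ∈ l) (hn : l.Nodup) {g : B ⊕ C → B ⊕ C}
    (hg : IsPairing g) :
    concat l g Sum.swap = g ∧ concatLoops l g (Sum.swap : B ⊕ B → B ⊕ B) = 0 := by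
  have := glueAll_swap_left l hn hg (isPairing_swap.sumMap hg) rfl
    (by rintro (i | c) <;> rcases h : g _ with (i' | c') <;> simp [hl, h]) (by simp)
  refine ⟨?_, this.2⟩
  funext x
  apply outer_injective (B := B)
  rw [← outer_concat hl hg isPairing_swap, this.1]

end Concat

/-! ### Planarity -/

section Planar

variable {T : Type*} [DecidableEq T]

/-- A pairing is non-crossing if, with respect to the position `pos` of the sites, there are no two
lines whose end points alternate. -/
def NonCrossing (pos : T → ℕ) (f : T → T) : Prop :=
  ∀ x y, ¬ (pos x < pos y ∧ pos y < pos (f x) ∧ pos (f x) < pos (f y))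

theorem NonCrossing.inside {pos : T → ℕ} (hpos : Function.Injective pos) {f : T → T}
    (hf : IsPairing f) (hn : NonCrossing pos f) (x y : T) (h1 : pos x < pos y)
    (h2 : pos y < pos (f x)) : pos x < pos (f y) ∧ pos (f y) < pos (f x) := by
  have e1 := hn x y
  have e2 := hn (f y) x
  rw [hf.invol] at e2
  have i1 : pos (f y) ≠ pos (f x) := fun h => by
    have := congrArg f (hpos h); rw [hf.invol, hf.invol] at this; subst this; omega
  have i2 : pos (f y) ≠ pos x := fun h => by
    have := congrArg f (hpos h); rw [hf.invol] at this; subst this; omega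
  omega

theorem NonCrossing.glue {pos : T → ℕ} (hpos : Function.Injective pos) {f : T → T}
    (hf : IsPairing f) (hn : NonCrossing pos f) {a b : T} (hab : pos a < pos b)
    (hin : ∀ x, pos a < pos x → pos x < pos b → pos a < pos (f x) ∧ pos (f x) < pos b) :
    NonCrossing pos (glue f a b) := by
  have hi := hn.inside hpos hf
  have h1 := hf.invol
  have hp : ∀ {x y : T}, x ≠ y → pos x ≠ pos y := fun h e => h (hpos e)
  rintro x y ⟨l1, l2, l3⟩
  have hF : ∀ u, (u = a ∧ TemperleyLieb.glue f a b u = b) ∨ (u = b ∧ TemperleyLieb.glue f a b u = a) ∨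
      (u = f a ∧ TemperleyLieb.glue f a b u = f b) ∨ (u = f b ∧ TemperleyLieb.glue f a b u = f a) ∨
      (TemperleyLieb.glue f a b u = f u ∧ pos u ≠ pos a ∧ pos u ≠ pos b ∧ pos (f u) ≠ pos a ∧
        pos (f u) ≠ pos b) := by
    intro u
    by_cases c1 : u = a
    · simp [TemperleyLieb.glue, c1]
    by_cases c2 : u = b
    · right; left; refine ⟨c2, ?_⟩; simp only [TemperleyLieb.glue]; rw [if_neg c1, if_pos c2]
    by_cases c3 : f u = a
    · right; right; left
      refine ⟨by rw [← c3, h1], ?_⟩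
      simp only [TemperleyLieb.glue]; rw [if_neg c1, if_neg c2, if_pos c3]
    by_cases c4 : f u = b
    · right; right; right; left
      refine ⟨by rw [← c4, h1], ?_⟩
      simp only [TemperleyLieb.glue]; rw [if_neg c1, if_neg c2, if_neg c3, if_pos c4]
    · right; right; right; right
      refine ⟨?_, hp c1, hp c2, hp c3, hp c4⟩
      simp only [TemperleyLieb.glue]; rw [if_neg c1, if_neg c2, if_neg c3, if_neg c4]
  have ia := hin (f a)
  have ib := hin (f b)
  have iy := hin y
  have ix := hin (f x)
  rw [h1] at ia ib ix
  rcases hF x with ⟨rfl, e⟩ | ⟨rfl, e⟩ | ⟨rfl, e⟩ | ⟨rfl, e⟩ | ⟨e, x1, x2, x3, x4⟩ <;>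
  rw [e] at l2 l3 <;>
  rcases hF y with ⟨rfl, e'⟩ | ⟨rfl, e'⟩ | ⟨rfl, e'⟩ | ⟨rfl, e'⟩ | ⟨e', y1, y2, y3, y4⟩ <;>
  (try rw [e'] at l3) <;> try omega
  · have t1 := hi y (f b)
    have t2 := hi y a
    have t3 := hin (f y)
    rw [h1] at t1 t3
    omega
  · have t1 := hi y (f a)
    have t2 := hi y b
    have t3 := hin (f y)
    rw [h1] at t1 t3
    omega
  · have t1 := hi x (f a)
    have t2 := hi x b
    have t3 := hin x
    rw [h1] at t1
    omega
  · have t1 := hi x (f b)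
    have t2 := hi x a
    have t3 := hin x
    rw [h1] at t1
    omega
  · exact hn x y ⟨l1, l2, l3⟩

/-- The position of the sites of an `(m, n)`-diagram on the boundary of the strip: first the `m`
bottom sites from left to right, then the `n` top sites from right to left. -/
def rowPos (m n : ℕ) : Fin m ⊕ Fin n → ℕ
  | Sum.inl i => i
  | Sum.inr j => m + (n - 1 - j)

theorem rowPos_lt {m n : ℕ} (x : Fin m ⊕ Fin n) : rowPos m n x < m + n := by
  rcases x with x | x <;> simp only [rowPos] <;> omega

theorem rowPos_injective (m n : ℕ) : Function.Injective (rowPos m n) := by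
  rintro (x | x) (y | y) h <;> simp only [rowPos] at h <;> simp only [Sum.inl.injEq, Sum.inr.injEq,
    reduceCtorEq, Fin.ext_iff] <;> omega

theorem rowPos_swap {m n : ℕ} (x : Fin m ⊕ Fin n) :
    rowPos n m x.swap + rowPos m n x + 1 = m + n := by
  rcases x with x | x <;> simp only [rowPos, Sum.swap_inl, Sum.swap_inr] <;> omega

theorem NonCrossing.reflect {m n : ℕ} {f : Fin m ⊕ Fin n → Fin m ⊕ Fin n} (hf : IsPairing f)
    (hn : NonCrossing (rowPos m n) f) : NonCrossing (rowPos n m) (reflect f) := by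
  intro x y h
  apply hn (f y.swap) (f x.swap)
  have e : ∀ z : Fin n ⊕ Fin m, rowPos n m z + rowPos m n z.swap + 1 = m + n := fun z => by
    have := rowPos_swap z.swap
    rwa [Sum.swap_swap] at this
  have e1 := e x
  have e2 := e y
  have e3 := e (TemperleyLieb.reflect f x)
  have e4 := e (TemperleyLieb.reflect f y)
  simp only [TemperleyLieb.reflect, Sum.swap_swap] at *
  rw [hf.invol, hf.invol]
  omega

/-- The position of all sites while two diagrams are concatenated. -/
def bigPos (m n p : ℕ) : (Fin m ⊕ Fin n) ⊕ (Fin n ⊕ Fin p) → ℕ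
  | Sum.inl x => rowPos m n x
  | Sum.inr y => m + n + rowPos n p y

theorem bigPos_injective (m n p : ℕ) : Function.Injective (bigPos m n p) := by
  rintro (x | x) (y | y) h <;> simp only [bigPos] at h
  · rw [rowPos_injective m n h]
  · have := rowPos_lt x; omega
  · have := rowPos_lt y; omega
  · rw [rowPos_injective n p (Nat.add_left_cancel h)]

theorem NonCrossing.sumMap {m n p : ℕ} {f : Fin m ⊕ Fin n → Fin m ⊕ Fin n}
    {g : Fin n ⊕ Fin p → Fin n ⊕ Fin p}
    (hf : NonCrossing (rowPos m n) f) (hg : NonCrossing (rowPos n p) g) :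
    NonCrossing (bigPos m n p) (Sum.map f g) := by
  rintro (x | x) (y | y) ⟨h1, h2, h3⟩ <;> simp only [bigPos, Sum.map_inl, Sum.map_inr] at h1 h2 h3
  · exact hf x y ⟨h1, h2, h3⟩
  · have := rowPos_lt (f x); omega
  · have := rowPos_lt y; omega
  · exact hg x y ⟨by omega, by omega, by omega⟩

theorem NonCrossing.glueAll_middle {m n p : ℕ} (l : List (Fin n)) (hl : l.Pairwise (· < ·))
    {f : (Fin m ⊕ Fin n) ⊕ (Fin n ⊕ Fin p) → (Fin m ⊕ Fin n) ⊕ (Fin n ⊕ Fin p)}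
    (hf : IsPairing f) (hn : NonCrossing (bigPos m n p) f)
    (h : ∀ i, i ∉ l → f (Sum.inl (Sum.inr i)) = Sum.inr (Sum.inl i)) :
    NonCrossing (bigPos m n p) (glueAll (middle (Fin m) (Fin p) l) f) := by
  induction l generalizing f with
  | nil => exact hn
  | cons j l ih =>
    obtain ⟨hj, hl⟩ := List.pairwise_cons.1 hl
    have hj' : ∀ i, i < j → f (Sum.inl (Sum.inr i)) = Sum.inr (Sum.inl i) := fun i hi => h i (by
      intro hm
      rcases List.mem_cons.1 hm with rfl | hm
      · exact absurd hi (lt_irrefl _)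
      · exact absurd (hj i hm) (not_lt.2 hi.le))
    have hj'' : ∀ i, i < j → f (Sum.inr (Sum.inl i)) = Sum.inl (Sum.inr i) := fun i hi => by
      rw [← hj' i hi, hf.invol]
    refine ih hl (hf.glue (by simp)) (hn.glue (bigPos_injective m n p) hf ?_ ?_) ?_
    · simp only [bigPos, rowPos]; omega
    · rintro ((x | x) | (x | x)) h1 h2 <;> simp only [bigPos, rowPos] at h1 h2
      · omega
      · rw [hj' x (by rw [Fin.lt_def]; omega)]
        simp only [bigPos, rowPos]
        omega
      · rw [hj'' x (by rw [Fin.lt_def]; omega)]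
        simp only [bigPos, rowPos]
        omega
      · omega
    · intro i hi
      by_cases hij : i = j
      · simp [TemperleyLieb.glue, hij]
      · simp [TemperleyLieb.glue, hij, h i (by simp [hij, hi])]

theorem NonCrossing.concat {m n p : ℕ} {f : Fin m ⊕ Fin n → Fin m ⊕ Fin n}
    {g : Fin n ⊕ Fin p → Fin n ⊕ Fin p} (hfp : IsPairing f) (hgp : IsPairing g)
    (hf : NonCrossing (rowPos m n) f) (hg : NonCrossing (rowPos n p) g) :
    NonCrossing (rowPos m p) (concat (List.finRange n) g f) := by
  have key := NonCrossing.glueAll_middle (List.finRange n) (List.pairwise_lt_finRange n)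
    (hfp.sumMap hgp) (hf.sumMap hg) (fun i hi => absurd (List.mem_finRange i) hi)
  intro x y h
  apply key (outer (Fin n) x) (outer (Fin n) y)
  have e : ∀ z : Fin m ⊕ Fin p, bigPos m n p (outer (Fin n) z) =
      rowPos m p z + (if rowPos m p z < m then 0 else n + n) := by
    rintro (z | z) <;> simp [bigPos, rowPos, outer]
    omega
  rw [outer_concat List.mem_finRange hgp hfp, outer_concat List.mem_finRange hgp hfp]
  simp only [e]
  split_ifs <;> omega

end Planar

/-! ### Diagrams -/

/-- An `(m, n)`-diagram up to isotopy: a pairing of `m` bottom and `n` top sites by lines which do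
not cross inside the strip. -/
@[ext]
structure Diagram (m n : ℕ) where
  line : Fin m ⊕ Fin n → Fin m ⊕ Fin n
  isPairing : IsPairing line
  planar : NonCrossing (rowPos m n) line

namespace Diagram

variable {m n p q : ℕ}

/-- The vertical concatenation with `d` below and `e` above, closed loops removed. -/
def comp (e : Diagram n p) (d : Diagram m n) : Diagram m p where
  line := concat (List.finRange n) e.line d.line
  isPairing := e.isPairing.concat List.mem_finRange d.isPairing
  planar := d.planar.concat d.isPairing e.isPairing e.planar

/-- The number of closed loops in the vertical concatenation with `d` below and `e` above. -/
def loops (e : Diagram n p) (d : Diagram m n) : ℕ :=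
  concatLoops (List.finRange n) e.line d.line

/-- The identity diagram: every bottom site is paired with the top site above it. -/
def id (n : ℕ) : Diagram n n where
  line := Sum.swap
  isPairing := isPairing_swap
  planar := by
    rintro (x | x) (y | y) <;> simp only [rowPos, Sum.swap_inl, Sum.swap_inr] <;> omega

/-- Reflection of a diagram across the horizontal axis. -/
def star (d : Diagram m n) : Diagram n m where
  line := reflect d.line
  isPairing := d.isPairing.reflect
  planar := d.planar.reflect d.isPairing

/-- The through degree: the number of lines that pair a bottom site with a top site. -/
def throughDegree (d : Diagram m n) : ℕ :=
  (Finset.univ.filter fun i : Fin m => (d.line (Sum.inl i)).isRight = true).card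

theorem comp_assoc (e : Diagram p q) (d : Diagram n p) (c : Diagram m n) :
    (e.comp d).comp c = e.comp (d.comp c) :=
  Diagram.ext (concat_assoc List.mem_finRange List.mem_finRange c.isPairing d.isPairing
    e.isPairing).1.symm

theorem loops_assoc (e : Diagram p q) (d : Diagram n p) (c : Diagram m n) :
    e.loops d + (e.comp d).loops c = d.loops c + e.loops (d.comp c) :=
  (concat_assoc List.mem_finRange List.mem_finRange c.isPairing d.isPairing e.isPairing).2.symm

theorem comp_id (d : Diagram m n) : d.comp (id m) = d :=
  Diagram.ext (concat_swap List.mem_finRange (List.nodup_finRange m) d.isPairing).1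

theorem loops_id (d : Diagram m n) : d.loops (id m) = 0 :=
  (concat_swap List.mem_finRange (List.nodup_finRange m) d.isPairing).2

theorem star_star (d : Diagram m n) : d.star.star = d := by
  ext x
  simp [star, reflect]

theorem star_id : (id n).star = id n := by
  ext x
  simp [star, id, reflect]

theorem star_comp (e : Diagram n p) (d : Diagram m n) : d.star.comp e.star = (e.comp d).star :=
  Diagram.ext (concat_reflect List.mem_finRange e.isPairing d.isPairing).1

theorem loops_star (e : Diagram n p) (d : Diagram m n) : d.star.loops e.star = e.loops d :=
  (concat_reflect List.mem_finRange e.isPairing d.isPairing).2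

theorem id_comp (d : Diagram m n) : (id n).comp d = d := by
  rw [← star_star ((id n).comp d), ← star_comp, star_id, comp_id, star_star]

theorem id_loops (d : Diagram m n) : (id n).loops d = 0 := by
  rw [← loops_star, star_id, loops_id]

/-- A line that joins two bottom sites survives concatenation from above. -/
theorem comp_line_inl (e : Diagram n p) (d : Diagram m n) {i j : Fin m}
    (h : d.line (Sum.inl i) = Sum.inl j) : (e.comp d).line (Sum.inl i) = Sum.inl j := by
  have key : ∀ (l : List (Fin n))
      (f : (Fin m ⊕ Fin n) ⊕ (Fin n ⊕ Fin p) → (Fin m ⊕ Fin n) ⊕ (Fin n ⊕ Fin p)),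
      f (Sum.inl (Sum.inl i)) = Sum.inl (Sum.inl j) →
      glueAll (middle (Fin m) (Fin p) l) f (Sum.inl (Sum.inl i)) = Sum.inl (Sum.inl j) := by
    intro l
    induction l with
    | nil => exact fun f hf => hf
    | cons b l ih =>
      intro f hf
      apply ih
      simp [glue, hf]
  apply outer_injective (B := Fin n)
  have := outer_concat List.mem_finRange e.isPairing d.isPairing (Sum.inl i)
  exact this.symm.trans (key _ _ (by simp [h]))

theorem throughDegree_comp_le (e : Diagram n p) (d : Diagram m n) :
    (e.comp d).throughDegree ≤ d.throughDegree := by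
  apply Finset.card_le_card
  intro i
  simp only [Finset.mem_filter, Finset.mem_univ, true_and]
  intro h
  rcases hd : d.line (Sum.inl i) with j | j
  · rw [comp_line_inl e d hd] at h
    simp at h
  · rfl

theorem throughDegree_id : (id n).throughDegree = n := by
  simp [throughDegree, id]

/-- If `e ∘ d` is the identity diagram, then both have maximal through degree. -/
theorem throughDegree_of_comp_eq_id (e : Diagram n m) (d : Diagram m n) (h : e.comp d = id m) :
    d.throughDegree = m ∧ e.star.throughDegree = m := by
  have le : ∀ d : Diagram m n, d.throughDegree ≤ m := fun d =>
    (Finset.card_le_univ _).trans (Fintype.card_fin m).le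
  refine ⟨le_antisymm (le _) ?_, le_antisymm (le _) ?_⟩
  · have := throughDegree_comp_le e d
    rwa [h, throughDegree_id] at this
  · have := throughDegree_comp_le d.star e.star
    rwa [star_comp, h, star_id, throughDegree_id] at this

/-- The diagram `y_m : m → n`: from left to right, the top row consists of `(n - m) / 2` cups on
neighbouring sites, followed by `m` propagating lines. -/
def y (m n : ℕ) (h : m ≤ n ∧ m % 2 = n % 2) : Diagram m n where
  line
    | Sum.inl i => Sum.inr ⟨n - m + i, by omega⟩
    | Sum.inr j =>
      if h1 : n - m ≤ j then Sum.inl ⟨j - (n - m), by omega⟩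
      else if h2 : (j : ℕ) % 2 = 0 then Sum.inr ⟨j + 1, by omega⟩
      else Sum.inr ⟨j - 1, by omega⟩
  isPairing := by
    constructor
    · rintro (i | j)
      · simp
      · by_cases h1 : n - m ≤ j
        · simp only [h1, dif_pos, Sum.inr.injEq, Fin.ext_iff]; omega
        · by_cases h2 : (j : ℕ) % 2 = 0
          · simp only [h1, h2, dif_pos, dif_neg, not_false_eq_true]
            rw [dif_neg (by omega), dif_neg (by omega)]
            simp
          · simp only [h1, h2, dif_neg, not_false_eq_true]
            rw [dif_neg (by omega), dif_pos (by omega)]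
            simp only [Sum.inr.injEq, Fin.ext_iff]; omega
    · rintro (i | j)
      · simp
      · simp only
        split_ifs <;> simp [Fin.ext_iff] <;> omega
  planar := by
    rintro (i | i) (j | j) <;> simp only [rowPos] <;> (try split_ifs) <;> (try simp only) <;>
      omega

/-- The diagram `z_m : m → n` for `m ≠ 0`: from left to right, the top row consists of one
propagating line, `(n - m) / 2` cups on neighbouring sites, and `m - 1` propagating lines. -/
def z (m n : ℕ) (h : m ≤ n ∧ m % 2 = n % 2) (h0 : m ≠ 0) : Diagram m n where
  line
    | Sum.inl i =>
      if (i : ℕ) = 0 then Sum.inr ⟨0, by omega⟩ else Sum.inr ⟨n - m + i, by omega⟩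
    | Sum.inr j =>
      if h1 : (j : ℕ) = 0 then Sum.inl ⟨0, by omega⟩
      else if h2 : n - m < j then Sum.inl ⟨j - (n - m), by omega⟩
      else if h3 : (j : ℕ) % 2 = 1 then Sum.inr ⟨j + 1, by omega⟩
      else Sum.inr ⟨j - 1, by omega⟩
  isPairing := by
    constructor
    · rintro (i | j)
      · by_cases h1 : (i : ℕ) = 0
        · simp only [h1, if_pos, dif_pos, Sum.inl.injEq, Fin.ext_iff]
        · simp only [h1, if_neg, not_false_eq_true]
          rw [dif_neg (by omega), dif_pos (by omega)]
          simp
      · by_cases h1 : (j : ℕ) = 0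
        · simp only [h1, dif_pos, if_pos, Sum.inr.injEq, Fin.ext_iff]
        · by_cases h2 : n - m < j
          · simp only [h1, h2, dif_pos, dif_neg, not_false_eq_true]
            rw [if_neg (by omega)]
            simp only [Sum.inr.injEq, Fin.ext_iff]; omega
          · by_cases h3 : (j : ℕ) % 2 = 1
            · simp only [h1, h2, h3, dif_pos, dif_neg, not_false_eq_true]
              rw [dif_neg (by omega), dif_neg (by omega),
                dif_neg (by omega)]
              simp
            · simp only [h1, h2, h3, dif_neg, not_false_eq_true]
              rw [dif_neg (by omega), dif_neg (by omega),
                dif_pos (by omega)]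
              simp only [Sum.inr.injEq, Fin.ext_iff]; omega
    · rintro (i | j)
      · simp only
        split_ifs <;> simp
      · simp only
        split_ifs <;> simp [Fin.ext_iff] <;> omega
  planar := by
    rintro (i | i) (j | j) <;> simp only [rowPos] <;> (try split_ifs) <;> (try simp only) <;>
      omega

end Diagram

/-! ### The Temperley–Lieb category and the Temperley–Lieb algebras -/

section Linear

universe u

variable {k : Type u} [CommRing k]

/-- The morphisms `m → n` in the Temperley–Lieb category with loop parameter `δ`: the free module
on all `(m, n)`-diagrams. -/
def Hom (_δ : k) (m n : ℕ) : Type u := Diagram m n →₀ k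

noncomputable instance (δ : k) (m n : ℕ) : AddCommGroup (Hom δ m n) :=
  inferInstanceAs (AddCommGroup (Diagram m n →₀ k))

noncomputable instance (δ : k) (m n : ℕ) : Module k (Hom δ m n) :=
  inferInstanceAs (Module k (Diagram m n →₀ k))

variable {m n p q : ℕ}

/-- A diagram as a morphism. -/
noncomputable def diag (δ : k) (d : Diagram m n) : Hom δ m n := Finsupp.single d 1

/-- The linear extension of a map on diagrams. -/
noncomputable def extend (δ : k) {V : Type*} [AddCommGroup V] [Module k V] (f : Diagram m n → V) :
    Hom δ m n →ₗ[k] V :=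
  Finsupp.linearCombination k f

theorem extend_diag (δ : k) {V : Type*} [AddCommGroup V] [Module k V] (f : Diagram m n → V)
    (d : Diagram m n) : extend δ f (diag δ d) = f d :=
  (Finsupp.linearCombination_single k 1 d).trans (one_smul k (f d))

/-- The coefficient of a diagram in a morphism. -/
noncomputable def coeff (δ : k) (d : Diagram m n) : Hom δ m n →ₗ[k] k :=
  Finsupp.lapply (M := k) (R := k) d

theorem coeff_diag_of_ne {δ : k} {d e : Diagram m n} (h : d ≠ e) : coeff δ d (diag δ e) = 0 :=
  Finsupp.single_eq_of_ne h

theorem hom_ext {δ : k} {V : Type*} [AddCommGroup V] [Module k V] {f g : Hom δ m n →ₗ[k] V}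
    (h : ∀ d, f (diag δ d) = g (diag δ d)) : f = g :=
  Finsupp.lhom_ext' fun d => LinearMap.ext_ring (h d)

/-- Composition of morphisms `x ∘ y`, as a bilinear map: diagrams are concatenated vertically, and
every closed loop is replaced by a factor `δ`. -/
noncomputable def compₗ (δ : k) (m n p : ℕ) : Hom δ n p →ₗ[k] Hom δ m n →ₗ[k] Hom δ m p :=
  extend δ fun e => extend δ fun d => δ ^ e.loops d • diag δ (e.comp d)

/-- Composition of morphisms `x ∘ y`. -/
noncomputable def comp {δ : k} (x : Hom δ n p) (y : Hom δ m n) : Hom δ m p := compₗ δ m n p x y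

/-- The reflection `*` across the horizontal axis, extended linearly. -/
noncomputable def starₗ (δ : k) (m n : ℕ) : Hom δ m n →ₗ[k] Hom δ n m :=
  extend δ fun d => diag δ d.star

theorem compₗ_diag (δ : k) (e : Diagram n p) (d : Diagram m n) :
    compₗ δ m n p (diag δ e) (diag δ d) = δ ^ e.loops d • diag δ (e.comp d) := by
  simp [compₗ, extend_diag]

theorem compₗ_assoc {δ : k} (x : Hom δ p q) (y : Hom δ n p) (z : Hom δ m n) :
    compₗ δ m n q (compₗ δ n p q x y) z = compₗ δ m p q x (compₗ δ m n p y z) := by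
  have : (compₗ δ n p q).compr₂ (compₗ δ m n q) =
      ((LinearMap.llcomp k (Hom δ m n) (Hom δ m p) (Hom δ m q)).flip.comp (compₗ δ m n p)).flip.comp
        (compₗ δ m p q) := by
    refine hom_ext fun e => hom_ext fun d => hom_ext fun c => ?_
    simp only [LinearMap.compr₂_apply, LinearMap.comp_apply, LinearMap.flip_apply,
      LinearMap.llcomp_apply, compₗ_diag, map_smul, LinearMap.smul_apply, smul_smul, ← pow_add,
      Diagram.comp_assoc, Diagram.loops_assoc]
  exact LinearMap.congr_fun (LinearMap.congr_fun (LinearMap.congr_fun this x) y) z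

theorem compₗ_id {δ : k} (x : Hom δ m n) : compₗ δ m m n x (diag δ (Diagram.id m)) = x := by
  have : (compₗ δ m m n).flip (diag δ (Diagram.id m)) = LinearMap.id := by
    refine hom_ext fun d => ?_
    simp [compₗ_diag, Diagram.comp_id, Diagram.loops_id]
  exact LinearMap.congr_fun this x

theorem id_compₗ {δ : k} (x : Hom δ m n) : compₗ δ m n n (diag δ (Diagram.id n)) x = x := by
  have : compₗ δ m n n (diag δ (Diagram.id n)) = LinearMap.id := by
    refine hom_ext fun d => ?_
    simp [compₗ_diag, Diagram.id_comp, Diagram.id_loops]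
  exact LinearMap.congr_fun this x

/-- The Temperley–Lieb algebra: the endomorphisms of the object `n`. -/
def TL (δ : k) (n : ℕ) : Type u := Hom δ n n

noncomputable instance instAddCommGroupTL (δ : k) (n : ℕ) : AddCommGroup (TL δ n) :=
  inferInstanceAs (AddCommGroup (Hom δ n n))

noncomputable instance (δ : k) (n : ℕ) : Module k (TL δ n) :=
  inferInstanceAs (Module k (Hom δ n n))

noncomputable instance (δ : k) (n : ℕ) : Ring (TL δ n) where
  __ := instAddCommGroupTL δ n
  mul x y := compₗ δ n n n x y
  one := diag δ (Diagram.id n)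
  mul_assoc := compₗ_assoc
  one_mul := id_compₗ
  mul_one := compₗ_id
  left_distrib x y z := map_add (compₗ δ n n n x) y z
  right_distrib x y z := LinearMap.map_add₂ (compₗ δ n n n) x y z
  zero_mul x := LinearMap.map_zero₂ (compₗ δ n n n) x
  mul_zero x := map_zero (compₗ δ n n n x)

noncomputable instance (δ : k) (n : ℕ) : Algebra k (TL δ n) :=
  Algebra.ofModule (fun r x y => LinearMap.map_smul₂ (compₗ δ n n n) r x y)
    (fun r x y => map_smul (compₗ δ n n n x) r y)

/-- The morphisms `m → n` of through degree less than `j`: the span of all diagrams of through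
degree less than `j`. -/
noncomputable def tdHom (δ : k) (j m n : ℕ) : Submodule k (Hom δ m n) :=
  Submodule.span k {x | ∃ d : Diagram m n, d.throughDegree < j ∧ x = diag δ d}

/-- `td(< j)` in the Temperley–Lieb algebra. -/
noncomputable def td (δ : k) (n j : ℕ) : Submodule k (TL δ n) := tdHom δ j n n

theorem compₗ_mem_tdHom {δ : k} {j : ℕ} (x : Hom δ n p) :
    tdHom δ j m n ≤ (tdHom δ j m p).comap (compₗ δ m n p x) := by
  refine Submodule.span_le.2 ?_
  rintro _ ⟨d, hd, rfl⟩
  have : (⊤ : Submodule k (Hom δ n p)) ≤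
      (tdHom δ j m p).comap ((compₗ δ m n p).flip (diag δ d)) := by
    have htop : Submodule.span k (Set.range (diag δ : Diagram n p → Hom δ n p)) = ⊤ :=
      (Finsupp.basisSingleOne (R := k) (ι := Diagram n p)).span_eq ▸ by
        congr 1
    rw [← htop, Submodule.span_le]
    rintro _ ⟨e, rfl⟩
    simp only [Submodule.comap_coe, Set.mem_preimage, LinearMap.flip_apply, compₗ_diag,
      SetLike.mem_coe]
    exact Submodule.smul_mem _ _ (Submodule.subset_span
      ⟨_, (Diagram.throughDegree_comp_le e d).trans_lt hd, rfl⟩)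
  exact this (Submodule.mem_top (x := x))

/-- The cell module `Δ_n(m)`: the morphisms `m → n` modulo those of through degree less than `m`.
The diagrams `m → n` with the maximal number `m` of propagating lines give a basis. -/
def Cell (δ : k) (n m : ℕ) : Type u := Hom δ m n ⧸ tdHom δ m m n

noncomputable instance (δ : k) (n m : ℕ) : AddCommGroup (Cell δ n m) :=
  inferInstanceAs (AddCommGroup (Hom δ m n ⧸ tdHom δ m m n))

noncomputable instance (δ : k) (n m : ℕ) : Module k (Cell δ n m) :=
  inferInstanceAs (Module k (Hom δ m n ⧸ tdHom δ m m n))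

/-- The class of a morphism in the cell module. -/
noncomputable def Cell.mk (δ : k) (n m : ℕ) : Hom δ m n →ₗ[k] Cell δ n m := (tdHom δ m m n).mkQ

theorem Cell.mk_surjective (δ : k) (n m : ℕ) : Function.Surjective (Cell.mk δ n m) :=
  (tdHom δ m m n).mkQ_surjective

/-- The Temperley–Lieb algebra acts on the cell module by composition. -/
noncomputable def Cell.act {δ : k} {n : ℕ} (m : ℕ) (x : TL δ n) : Cell δ n m →ₗ[k] Cell δ n m :=
  Submodule.mapQ _ _ (compₗ δ m n n x) (compₗ_mem_tdHom x)

theorem Cell.act_mk {δ : k} (x : TL δ n) (c : Hom δ m n) :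
    Cell.act m x (Cell.mk δ n m c) = Cell.mk δ n m (compₗ δ m n n x c) := rfl

noncomputable instance (δ : k) (n m : ℕ) : Module (TL δ n) (Cell δ n m) where
  smul x c := Cell.act m x c
  one_smul c := by
    obtain ⟨c, rfl⟩ := Cell.mk_surjective δ n m c
    exact congrArg (Cell.mk δ n m) (id_compₗ c)
  mul_smul x y c := by
    obtain ⟨c, rfl⟩ := Cell.mk_surjective δ n m c
    exact congrArg (Cell.mk δ n m) (compₗ_assoc x y c)
  smul_zero x := map_zero (Cell.act m x)
  smul_add x := map_add (Cell.act m x)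
  add_smul x y c := by
    obtain ⟨c, rfl⟩ := Cell.mk_surjective δ n m c
    exact (congrArg (Cell.mk δ n m) (LinearMap.map_add₂ (compₗ δ m n n) x y c)).trans
      (map_add (Cell.mk δ n m) _ _)
  zero_smul c := by
    obtain ⟨c, rfl⟩ := Cell.mk_surjective δ n m c
    exact (congrArg (Cell.mk δ n m) (LinearMap.map_zero₂ (compₗ δ m n n) c)).trans
      (map_zero (Cell.mk δ n m))

instance (δ : k) (n m : ℕ) : IsScalarTower k (TL δ n) (Cell δ n m) where
  smul_assoc r x c := by
    obtain ⟨c, rfl⟩ := Cell.mk_surjective δ n m c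
    exact (congrArg (Cell.mk δ n m) (LinearMap.map_smul₂ (compₗ δ m n n) r x c)).trans
      (map_smul (Cell.mk δ n m) r _)

/-! ### The bilinear form on cell modules -/

/-- The coefficient of the identity diagram in `x* ∘ y`. -/
noncomputable def formHom (δ : k) (n m : ℕ) : Hom δ m n →ₗ[k] Hom δ m n →ₗ[k] k :=
  ((compₗ δ m n m).comp (starₗ δ m n)).compr₂ (coeff δ (Diagram.id m))

theorem formHom_diag {δ : k} {d e : Diagram m n} (h : d.throughDegree < m ∨ e.throughDegree < m) :
    formHom δ n m (diag δ d) (diag δ e) = 0 := by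
  have hne : d.star.comp e ≠ Diagram.id m := fun H => by
    have := Diagram.throughDegree_of_comp_eq_id _ _ H
    rw [Diagram.star_star] at this
    omega
  rw [formHom, LinearMap.compr₂_apply, LinearMap.comp_apply, starₗ, extend_diag, compₗ_diag, map_smul,
    coeff_diag_of_ne hne.symm, smul_zero]

theorem formHom_left {δ : k} : tdHom δ m m n ≤ LinearMap.ker (formHom δ n m) := by
  refine Submodule.span_le.2 ?_
  rintro _ ⟨d, hd, rfl⟩
  refine LinearMap.mem_ker.2 (hom_ext fun e => ?_)
  rw [formHom_diag (Or.inl hd), LinearMap.zero_apply]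

theorem formHom_right {δ : k} : tdHom δ m m n ≤ LinearMap.ker (formHom δ n m).flip := by
  refine Submodule.span_le.2 ?_
  rintro _ ⟨d, hd, rfl⟩
  refine LinearMap.mem_ker.2 (hom_ext fun e => ?_)
  rw [LinearMap.flip_apply, formHom_diag (Or.inr hd), LinearMap.zero_apply]

/-- The bilinear form on the cell module: `⟨x, y⟩` is the coefficient of the identity diagram in
`x* ∘ y`. -/
noncomputable def form (δ : k) (n m : ℕ) : Cell δ n m →ₗ[k] Cell δ n m →ₗ[k] k :=
  ((tdHom δ m m n).liftQ ((tdHom δ m m n).liftQ (formHom δ n m) formHom_left).flip (by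
    intro y hy
    refine LinearMap.mem_ker.2 (LinearMap.ext fun x => ?_)
    obtain ⟨x, rfl⟩ := (tdHom δ m m n).mkQ_surjective x
    exact LinearMap.congr_fun (LinearMap.mem_ker.1 (formHom_right hy)) x)).flip

theorem form_mk {δ : k} (x y : Hom δ m n) :
    form δ n m (Cell.mk δ n m x) (Cell.mk δ n m y) = formHom δ n m x y := rfl

/-- The radical of the bilinear form: all `x` with `⟨x, y⟩ = 0` for all `y`. -/
noncomputable def rad (δ : k) (n m : ℕ) : Submodule k (Cell δ n m) := LinearMap.ker (form δ n m)

/-- The index set `Λ` of the cell modules. -/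
def Lam (n : ℕ) : Set ℕ := {m | m ≤ n ∧ m % 2 = n % 2}

/-- The set `Λ₀` of all `m` for which the bilinear form on the cell module is not zero. -/
def Lam0 (δ : k) (n : ℕ) : Set ℕ := {m | m ∈ Lam n ∧ rad δ n m ≠ ⊤}

end Linear

/-! ### The idempotents, and the vectors in the homomorphism criterion -/

section Criterion

universe u v

variable {k : Type u} [Field k]

/-- The idempotent: `y_m ∘ z_m*` for `m ≠ 0`, and `δ^(-n/2) y_0 ∘ y_0*` for `m = 0`. -/
noncomputable def yz (δ : k) {n m : ℕ} (h : m ∈ Lam n) : TL δ n :=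
  if h0 : m = 0 then
    (δ ^ (n / 2))⁻¹ • (comp (diag δ (Diagram.y m n h)) (starₗ δ m n (diag δ (Diagram.y m n h))) :
      Hom δ n n)
  else comp (diag δ (Diagram.y m n h)) (starₗ δ m n (diag δ (Diagram.z m n h h0)))

/-- The class of the diagram `y_m` in the cell module. -/
noncomputable def yCell (δ : k) {n m : ℕ} (h : m ∈ Lam n) : Cell δ n m :=
  Cell.mk δ n m (diag δ (Diagram.y m n h))

/-- The subspace of all `v` in `M` with `td(< m) v = 0` and `y_m z_m* v = v`. -/
noncomputable def critVectors (δ : k) {n m : ℕ} (h : m ∈ Lam n) (M : Type v) [AddCommGroup M] [Module k M]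
    [Module (TL δ n) M] [IsScalarTower k (TL δ n) M] : Submodule k M where
  carrier := {v | (∀ x ∈ td δ n m, x • v = 0) ∧ yz δ h • v = v}
  zero_mem' := by simp
  add_mem' := by
    rintro v w ⟨h1, h2⟩ ⟨h3, h4⟩
    exact ⟨fun x hx => by rw [smul_add, h1 x hx, h3 x hx, add_zero], by rw [smul_add, h2, h4]⟩
  smul_mem' := by
    rintro r v ⟨h1, h2⟩
    exact ⟨fun x hx => by rw [smul_comm, h1 x hx, smul_zero], by rw [smul_comm, h2]⟩

end Criterion

end TemperleyLieb

/-!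
The proof rests on one construction: a morphism `ζ : n → m` with `ζ ∘ y_m = id_m` and
`y_m z_m* = y_m ∘ ζ`. Given such a `ζ`, every `c : m → n` is `(c ∘ ζ) ∘ y_m`. So `Δ_n(m)` is
generated by the class of `y_m`, and a homomorphism `φ` is determined by `φ(y_m)`; since `y_m` is
fixed by `y_m ∘ ζ` and the through degree of a composite is at most that of its upper factor,
`φ(y_m)` satisfies the two conditions. Conversely, if `v` satisfies them, then `c ↦ (c ∘ ζ) • v`
vanishes on the morphisms of through degree less than `m`, commutes with the action of `TL_n`, and
sends `y_m` to `v`. This is `exists_homEquiv`.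

For `m ≠ 0` one takes `ζ = z_m*`: the cups of `y_m` and the caps of `z_m*` are shifted by one site,
so they straighten to a single line and no loop closes (`Diagram.star_z_comp_y`). For `m = 0` one
takes `ζ = δ^(-n/2) y_0*`: cups and caps close up pairwise to `n / 2` loops
(`Diagram.loops_star_y_y`). Here `δ^(n/2)` has to be invertible. It is, because for `n > 0` the
composite of any `0 → n` with any `n → 0` has a closed loop (`Diagram.loops_pos`), so the form on
`Δ_n(0)` would vanish for `δ = 0`.

The two explicit composites are computed by gluing the middle sites from left to right, with
formulas for the pairing after each step. To avoid bounds on the sites, these pairings live on rows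
indexed by `ℕ`, into which the rows of a diagram embed.
-/

namespace TemperleyLieb

/-! ### Through degree and the upper factor -/

namespace Diagram

variable {m n p : ℕ}

theorem throughDegree_star_le (d : Diagram m n) : d.star.throughDegree ≤ d.throughDegree := by
  refine Finset.card_le_card_of_forall_subsingleton
    (fun j i => d.line (Sum.inr j) = Sum.inl i) ?_ ?_
  · intro j hj
    rcases h : d.line (Sum.inr j) with i | i
    · refine ⟨i, ?_, rfl⟩
      have := d.isPairing.invol (Sum.inr j)
      rw [h] at this
      simp [this]
    · simp [star, reflect, h] at hj
  · rintro i - j ⟨-, hj⟩ j' ⟨-, hj'⟩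
    have := congrArg d.line (hj.trans hj'.symm)
    simpa [d.isPairing.invol] using this

theorem throughDegree_star (d : Diagram m n) : d.star.throughDegree = d.throughDegree :=
  le_antisymm d.throughDegree_star_le (by simpa [star_star] using d.star.throughDegree_star_le)

theorem throughDegree_comp_le_left (e : Diagram n p) (d : Diagram m n) :
    (e.comp d).throughDegree ≤ e.throughDegree := by
  rw [← throughDegree_star, ← star_comp, ← throughDegree_star e]
  exact throughDegree_comp_le _ _

end Diagram

theorem compₗ_mem_tdHom_left {k : Type*} [CommRing k] {δ : k} {j m n p : ℕ} {x : Hom δ n p}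
    (hx : x ∈ tdHom δ j n p) (y : Hom δ m n) : compₗ δ m n p x y ∈ tdHom δ j m p := by
  have key : tdHom δ j n p ≤ (tdHom δ j m p).comap ((compₗ δ m n p).flip y) := by
    refine Submodule.span_le.2 ?_
    rintro _ ⟨e, he, rfl⟩
    have hy : y ∈ Submodule.span k (Set.range (diag δ : Diagram m n → Hom δ m n)) := by
      have : Submodule.span k (Set.range (diag δ : Diagram m n → Hom δ m n)) = ⊤ :=
        (Finsupp.basisSingleOne (R := k) (ι := Diagram m n)).span_eq ▸ by congr 1
      rw [this]
      trivial
    refine (Submodule.span_le (p := (tdHom δ j m p).comap (compₗ δ m n p (diag δ e)))).2 ?_ hy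
    rintro _ ⟨d, rfl⟩
    simp only [Submodule.comap_coe, Set.mem_preimage, compₗ_diag, SetLike.mem_coe]
    exact Submodule.smul_mem _ _ (Submodule.subset_span
      ⟨_, (Diagram.throughDegree_comp_le_left e d).trans_lt he, rfl⟩)
  exact key hx

/-! ### Homomorphisms out of a cell module -/

section HomCell

variable {k : Type*} [Field k] {δ : k} {n m : ℕ}
  {M : Type*} [AddCommGroup M] [Module k M] [Module (TL δ n) M] [IsScalarTower k (TL δ n) M]

/-- The composite `x ∘ ζ` of `x : m → n` and `ζ : n → m`, as an element of `TL_n`. -/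
noncomputable def endo (x : Hom δ m n) (ζ : Hom δ n m) : TL δ n := compₗ δ n m n x ζ

theorem endo_smul_mk (x : Hom δ m n) (ζ : Hom δ n m) (c : Hom δ m n) :
    endo x ζ • Cell.mk δ n m c = Cell.mk δ n m (compₗ δ m m n x (compₗ δ m n m ζ c)) :=
  congrArg (Cell.mk δ n m) (compₗ_assoc x ζ c)

/-- The homomorphism `c ↦ (c ∘ ζ) • v` from the cell module, for a vector `v` which is annihilated
by `td(< m)`. -/
noncomputable def Cell.homOfVector (ζ : Hom δ n m) (v : M) (hv : ∀ x ∈ td δ n m, x • v = 0) :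
    Cell δ n m →ₗ[TL δ n] M :=
  let F : Hom δ m n →ₗ[k] M :=
    { toFun := fun c => endo c ζ • v
      map_add' := fun c c' =>
        (congrArg (fun x : TL δ n => x • v) (LinearMap.map_add₂ (compₗ δ n m n) c c' ζ)).trans
          (add_smul (endo c ζ) (endo c' ζ) v)
      map_smul' := fun r c =>
        (congrArg (fun x : TL δ n => x • v) (LinearMap.map_smul₂ (compₗ δ n m n) r c ζ)).trans
          (smul_assoc r (endo c ζ) v) }
  let G : Cell δ n m →ₗ[k] M :=
    (tdHom δ m m n).liftQ F fun c hc =>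
      LinearMap.mem_ker.2 (hv (endo c ζ) (compₗ_mem_tdHom_left hc ζ))
  { toFun := G
    map_add' := map_add G
    map_smul' := by
      intro x c
      obtain ⟨c, rfl⟩ := Cell.mk_surjective δ n m c
      exact (congrArg (fun x : TL δ n => x • v) (compₗ_assoc x c ζ)).trans
        (mul_smul x (endo c ζ) v) }

/-- The criterion, given a left inverse `ζ` of `y_m` for which `y_m ∘ ζ` is the idempotent. -/
theorem exists_homEquiv (h : m ∈ Lam n) (ζ : Hom δ n m)
    (hζ : compₗ δ m n m ζ (diag δ (Diagram.y m n h)) = diag δ (Diagram.id m))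
    (hyz : yz δ h = endo (diag δ (Diagram.y m n h)) ζ) :
    ∃ e : (Cell δ n m →ₗ[TL δ n] M) ≃ₗ[k] critVectors δ h M,
      ∀ φ : Cell δ n m →ₗ[TL δ n] M, (e φ : M) = φ (yCell δ h) := by
  have hgen : ∀ c : Hom δ m n, endo c ζ • yCell δ h = Cell.mk δ n m c := by
    intro c
    have := endo_smul_mk c ζ (diag δ (Diagram.y m n h))
    rwa [hζ, compₗ_id] at this
  have hcrit : ∀ φ : Cell δ n m →ₗ[TL δ n] M, φ (yCell δ h) ∈ critVectors δ h M := by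
    intro φ
    refine ⟨fun x hx => ?_, ?_⟩
    · have : x • yCell δ h = 0 :=
        (Submodule.Quotient.mk_eq_zero _).2 (compₗ_mem_tdHom_left hx _)
      rw [← map_smul, this, map_zero]
    · rw [← map_smul, hyz, hgen]
      rfl
  let E : (Cell δ n m →ₗ[TL δ n] M) →ₗ[k] critVectors δ h M :=
    { toFun := fun φ => ⟨φ (yCell δ h), hcrit φ⟩
      map_add' := fun _ _ => rfl
      map_smul' := fun _ _ => rfl }
  refine ⟨LinearEquiv.ofBijective E ⟨?_, ?_⟩, fun φ => rfl⟩
  · intro φ ψ hE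
    have hE' : φ (yCell δ h) = ψ (yCell δ h) := congrArg Subtype.val hE
    refine LinearMap.ext fun c => ?_
    obtain ⟨c, rfl⟩ := Cell.mk_surjective δ n m c
    rw [← hgen, map_smul, map_smul, hE']
  · rintro ⟨v, hv1, hv2⟩
    refine ⟨Cell.homOfVector ζ v hv1, Subtype.ext ?_⟩
    -- the value of the homomorphism at `y_m` is `(y_m ∘ ζ) • v` by definition
    rw [hyz] at hv2
    exact hv2

end HomCell

/-! ### Gluing on rows indexed by the natural numbers -/

/-- Four rows of sites, each indexed by `ℕ`, in the order bottom row, two copies of the middle row,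
top row. -/
abbrev NatSites : Type := (ℕ ⊕ ℕ) ⊕ (ℕ ⊕ ℕ)

/-- The embedding of the sites of two diagrams, one above the other, into four infinite rows. -/
def toNatSites {m n p : ℕ} : (Fin m ⊕ Fin n) ⊕ (Fin n ⊕ Fin p) → NatSites :=
  Sum.map (Sum.map Fin.val Fin.val) (Sum.map Fin.val Fin.val)

theorem toNatSites_injective {m n p : ℕ} :
    Function.Injective (toNatSites : (Fin m ⊕ Fin n) ⊕ (Fin n ⊕ Fin p) → NatSites) :=
  Sum.map_injective.2 ⟨Sum.map_injective.2 ⟨Fin.val_injective, Fin.val_injective⟩,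
    Sum.map_injective.2 ⟨Fin.val_injective, Fin.val_injective⟩⟩

theorem map_toNatSites_middle (m n p : ℕ) :
    (middle (Fin m) (Fin p) (List.finRange n)).map (Prod.map toNatSites toNatSites) =
      middle ℕ ℕ (List.range' 0 n) := by
  rw [← List.range_eq_range', ← List.map_coe_finRange_eq_range]
  simp only [middle, List.map_map]
  rfl

/-- If `F j` is the pairing after gluing the middle sites before `j`, then gluing all sites of the
interval from `j` to `j + s` leads from `F j` to `F (j + s)`, and the closed loops are counted by
any `N` which grows by one at the steps that close a loop. -/
theorem glueAll_range' {F : ℕ → NatSites → NatSites} {N : ℕ → ℕ}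
    (hF : ∀ j, glue (F j) (Sum.inl (Sum.inr j)) (Sum.inr (Sum.inl j)) = F (j + 1))
    (hN : ∀ j, ind (F j (Sum.inl (Sum.inr j))) (Sum.inr (Sum.inl j)) + N j = N (j + 1))
    (j s : ℕ) :
    glueAll (middle ℕ ℕ (List.range' j s)) (F j) = F (j + s) ∧
      glueLoops (middle ℕ ℕ (List.range' j s)) (F j) + N j = N (j + s) := by
  induction s generalizing j with
  | zero => simp [middle, glueAll, glueLoops]
  | succ s ih =>
    have := ih (j + 1)
    have h := hN j
    rw [show j + 1 + s = j + (s + 1) by omega, ← hF j] at this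
    simp only [middle, List.range'_succ, List.map_cons, glueAll, glueLoops] at this ⊢
    exact ⟨this.1, by omega⟩

namespace Diagram

variable {m n p : ℕ}

/-- The composite of two diagrams, read off from the pairings `F j` of the infinite rows which arise
by gluing the first `j` middle sites. -/
theorem concat_of_natSites (e : Diagram n p) (d : Diagram m n) {F : ℕ → NatSites → NatSites}
    {N : ℕ → ℕ} (h0 : ∀ x, F 0 (toNatSites x) = toNatSites (Sum.map d.line e.line x))
    (hF : ∀ j, glue (F j) (Sum.inl (Sum.inr j)) (Sum.inr (Sum.inl j)) = F (j + 1))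
    (hN : ∀ j, ind (F j (Sum.inl (Sum.inr j))) (Sum.inr (Sum.inl j)) + N j = N (j + 1)) :
    (∀ x, toNatSites (outer (Fin n) ((e.comp d).line x)) = F n (toNatSites (outer (Fin n) x))) ∧
      e.loops d + N 0 = N n := by
  have G := glueAll_map toNatSites_injective h0 (middle (Fin m) (Fin p) (List.finRange n))
  have R := glueAll_range' hF hN 0 n
  rw [map_toNatSites_middle, R.1, Nat.zero_add] at G
  rw [G.2, Nat.zero_add] at R
  refine ⟨fun x => ?_, R.2⟩
  rw [G.1, outer_concat List.mem_finRange e.isPairing d.isPairing]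
  rfl

/-! ### The composite of `y` with the reflection of `z` -/

/-- The pairing after gluing the first `j` middle sites of `z* ∘ y`, where `r = n - m` is the number
of sites on cups. For `j ≤ r`, the line from the leftmost top site has been straightened up to the
site `j` of the middle row: it ends on the upper copy if `j` is even, and on the lower copy if `j`
is odd. -/
def zigzag (r j : ℕ) : NatSites → NatSites
  | Sum.inl (Sum.inl i) =>
    if r + i < j then Sum.inr (Sum.inr i) else Sum.inl (Sum.inr (r + i))
  | Sum.inl (Sum.inr i) =>
    if i < j then Sum.inr (Sum.inl i)
    else if r ≤ i then Sum.inl (Sum.inl (i - r))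
    else if i = j ∧ j % 2 = 1 then Sum.inr (Sum.inr 0)
    else if i % 2 = 0 then Sum.inl (Sum.inr (i + 1)) else Sum.inl (Sum.inr (i - 1))
  | Sum.inr (Sum.inl i) =>
    if i < j then Sum.inl (Sum.inr i)
    else if r < i then Sum.inr (Sum.inr (i - r))
    else if i = j ∧ j % 2 = 0 then Sum.inr (Sum.inr 0)
    else if i % 2 = 1 then Sum.inr (Sum.inl (i + 1)) else Sum.inr (Sum.inl (i - 1))
  | Sum.inr (Sum.inr i) =>
    if r + i < j then Sum.inl (Sum.inl i)
    else if i ≠ 0 then Sum.inr (Sum.inl (r + i))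
    else if j % 2 = 0 then Sum.inr (Sum.inl j) else Sum.inl (Sum.inr j)

theorem glue_zigzag {r : ℕ} (hr : r % 2 = 0) (j : ℕ) :
    glue (zigzag r j) (Sum.inl (Sum.inr j)) (Sum.inr (Sum.inl j)) = zigzag r (j + 1) := by
  funext x
  rcases x with (i | i) | (i | i) <;> simp only [glue, zigzag] <;> grind

theorem zigzag_ne (r j : ℕ) : zigzag r j (Sum.inl (Sum.inr j)) ≠ Sum.inr (Sum.inl j) := by
  simp only [zigzag]
  grind

theorem zigzag_zero (h : m ≤ n ∧ m % 2 = n % 2) (h0 : m ≠ 0)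
    (x : (Fin m ⊕ Fin n) ⊕ (Fin n ⊕ Fin m)) :
    zigzag (n - m) 0 (toNatSites x) =
      toNatSites (Sum.map (y m n h).line (z m n h h0).star.line x) := by
  rcases x with (i | i) | (i | i) <;>
    simp only [zigzag, toNatSites, y, z, star, reflect, Sum.map_inl, Sum.map_inr, Sum.swap_inl,
      Sum.swap_inr] <;>
    grind

theorem star_z_comp_y (h : m ≤ n ∧ m % 2 = n % 2) (h0 : m ≠ 0) :
    (z m n h h0).star.comp (y m n h) = id m ∧ (z m n h h0).star.loops (y m n h) = 0 := by
  have K := concat_of_natSites (z m n h h0).star (y m n h) (N := fun _ => 0) (zigzag_zero h h0)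
    (glue_zigzag (by omega)) (by simp [ind, zigzag_ne])
  refine ⟨?_, K.2⟩
  ext x
  apply outer_injective (B := Fin n)
  apply toNatSites_injective
  rw [K.1]
  rcases x with i | i <;> simp [toNatSites, outer, zigzag, id] <;> omega

/-! ### Closed loops -/

/-- The pairing after gluing the first `j` middle sites of `y* ∘ y` for `y : 0 → n`. If `j` is odd,
then the two copies of the site `j` are joined by a line, and the next step closes a loop. The outer
rows are empty in this case, and get a dummy value. -/
def cupCap (j : ℕ) : NatSites → NatSites
  | Sum.inl (Sum.inl i) => Sum.inl (Sum.inl i)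
  | Sum.inl (Sum.inr i) =>
    if i < j ∨ i = j ∧ j % 2 = 1 then Sum.inr (Sum.inl i)
    else if i % 2 = 0 then Sum.inl (Sum.inr (i + 1)) else Sum.inl (Sum.inr (i - 1))
  | Sum.inr (Sum.inl i) =>
    if i < j ∨ i = j ∧ j % 2 = 1 then Sum.inl (Sum.inr i)
    else if i % 2 = 0 then Sum.inr (Sum.inl (i + 1)) else Sum.inr (Sum.inl (i - 1))
  | Sum.inr (Sum.inr i) => Sum.inr (Sum.inr i)

theorem glue_cupCap (j : ℕ) :
    glue (cupCap j) (Sum.inl (Sum.inr j)) (Sum.inr (Sum.inl j)) = cupCap (j + 1) := by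
  funext x
  rcases x with (i | i) | (i | i) <;> simp only [glue, cupCap] <;> grind

theorem ind_cupCap (j : ℕ) :
    ind (cupCap j (Sum.inl (Sum.inr j))) (Sum.inr (Sum.inl j)) + j / 2 = (j + 1) / 2 := by
  simp only [ind, cupCap]
  grind

theorem cupCap_zero (h : 0 ≤ n ∧ 0 % 2 = n % 2) (x : (Fin 0 ⊕ Fin n) ⊕ (Fin n ⊕ Fin 0)) :
    cupCap 0 (toNatSites x) = toNatSites (Sum.map (y 0 n h).line (y 0 n h).star.line x) := by
  rcases x with (i | i) | (i | i)
  · exact i.elim0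
  · simp only [cupCap, toNatSites, y, Sum.map_inl, Sum.map_inr]
    grind
  · simp only [cupCap, toNatSites, y, star, reflect, Sum.map_inl, Sum.map_inr, Sum.swap_inl]
    grind
  · exact i.elim0

theorem loops_star_y_y (h : 0 ≤ n ∧ 0 % 2 = n % 2) : (y 0 n h).star.loops (y 0 n h) = n / 2 :=
  (concat_of_natSites (y 0 n h).star (y 0 n h) (N := fun j => j / 2) (cupCap_zero h) glue_cupCap
    ind_cupCap).2

theorem eq_id_zero (d : Diagram 0 0) : d = id 0 := by
  ext x
  rcases x with i | i <;> exact i.elim0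

/-- If the outer rows are empty, then gluing the last middle site closes a loop, since all other
sites have been used up. -/
theorem glueLoops_middle_pos (l : List (Fin n)) (hl : l ≠ [])
    {f : (Fin 0 ⊕ Fin n) ⊕ (Fin n ⊕ Fin 0) → (Fin 0 ⊕ Fin n) ⊕ (Fin n ⊕ Fin 0)}
    (hf : IsPairing f) (h : ∀ i, i ∉ l → f (Sum.inl (Sum.inr i)) = Sum.inr (Sum.inl i)) :
    0 < glueLoops (middle (Fin 0) (Fin 0) l) f := by
  induction l generalizing f with
  | nil => exact absurd rfl hl
  | cons j l ih =>
    simp only [middle, List.map_cons, glueLoops]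
    by_cases hl' : l = []
    · subst hl'
      have : f (Sum.inl (Sum.inr j)) = Sum.inr (Sum.inl j) := by
        have h1 := hf.invol
        have h2 := hf.ne (Sum.inl (Sum.inr j))
        rcases e : f (Sum.inl (Sum.inr j)) with (i | i) | (i | i)
        · exact i.elim0
        · have hij : i ≠ j := fun hij => h2 (by rw [e, hij])
          have h3 := h i (by simp [hij])
          rw [← e, h1] at h3
          simp at h3
        · by_cases hij : i = j
          · rw [hij]
          · have h3 := congrArg f (h i (by simp [hij]))
            rw [h1, ← e, h1] at h3
            simp [hij] at h3
        · exact i.elim0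
      simp [this, ind]
    · refine Nat.add_pos_right _ (ih hl' (hf.glue (by simp)) fun i hi => ?_)
      by_cases hij : i = j
      · simp [glue, hij]
      · simp [glue, hij, h i (by simp [hij, hi])]

theorem loops_pos (hn : n ≠ 0) (e : Diagram n 0) (d : Diagram 0 n) : 0 < e.loops d :=
  glueLoops_middle_pos _ (by simpa using hn) (d.isPairing.sumMap e.isPairing)
    fun i hi => absurd (List.mem_finRange i) hi

end Diagram

/-! ### The left inverse of `y_m` -/

variable {k : Type*} [Field k] {δ : k} {n m : ℕ}

/-- For `δ = 0` and `n > 0` the form on `Δ_n(0)` vanishes, since every closed diagram contains a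
loop. -/
theorem pow_ne_zero_of_zero_mem_Lam0 (h : 0 ∈ Lam0 δ n) : δ ^ (n / 2) ≠ 0 := by
  rcases eq_or_ne n 0 with rfl | hn
  · simp
  refine pow_ne_zero _ fun hδ => h.2 ?_
  have hform : formHom δ n 0 = 0 := by
    refine hom_ext fun d => hom_ext fun e => ?_
    rw [formHom, LinearMap.compr₂_apply, LinearMap.comp_apply, starₗ, extend_diag, compₗ_diag, hδ,
      zero_pow (Diagram.loops_pos hn _ _).ne', zero_smul, map_zero]
    rfl
  refine LinearMap.ker_eq_top.2 (LinearMap.ext fun c => LinearMap.ext fun c' => ?_)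
  obtain ⟨c, rfl⟩ := Cell.mk_surjective δ n 0 c
  obtain ⟨c', rfl⟩ := Cell.mk_surjective δ n 0 c'
  rw [form_mk, hform]
  rfl

/-- The left inverse `z_m*` or `δ^(-n/2) y_0*` of `y_m`, which gives rise to the idempotent. -/
theorem exists_leftInverse_y (h : m ∈ Lam n) (hδ : m = 0 → δ ^ (n / 2) ≠ 0) : ∃ ζ : Hom δ n m,
    compₗ δ m n m ζ (diag δ (Diagram.y m n h)) = diag δ (Diagram.id m) ∧
      yz δ h = endo (diag δ (Diagram.y m n h)) ζ := by
  by_cases h0 : m = 0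
  · subst h0
    refine ⟨(δ ^ (n / 2))⁻¹ • starₗ δ 0 n (diag δ (Diagram.y 0 n h)), ?_, ?_⟩
    · rw [LinearMap.map_smul₂, starₗ, extend_diag, compₗ_diag, Diagram.loops_star_y_y h, smul_smul,
        inv_mul_cancel₀ (hδ rfl), one_smul, Diagram.eq_id_zero (Diagram.comp _ _)]
    · exact (dif_pos rfl).trans (map_smul (compₗ δ n 0 n (diag δ (Diagram.y 0 n h))) _ _).symm
  · refine ⟨starₗ δ m n (diag δ (Diagram.z m n h h0)), ?_, dif_neg h0⟩
    have := Diagram.star_z_comp_y h h0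
    rw [starₗ, extend_diag, compₗ_diag, this.1, this.2, pow_zero, one_smul]

end TemperleyLieb

theorem mainTheorem9 {k : Type*} [Field k] (δ : k) (n m : ℕ) (hm : m ∈ TemperleyLieb.Lam0 δ n)
    (M : Type*) [AddCommGroup M] [Module k M] [Module (TemperleyLieb.TL δ n) M]
    [IsScalarTower k (TemperleyLieb.TL δ n) M] :
    ∃ e : (TemperleyLieb.Cell δ n m →ₗ[TemperleyLieb.TL δ n] M) ≃ₗ[k]
        TemperleyLieb.critVectors δ hm.1 M,
      ∀ φ : TemperleyLieb.Cell δ n m →ₗ[TemperleyLieb.TL δ n] M,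
        (e φ : M) = φ (TemperleyLieb.yCell δ hm.1) := by
  obtain ⟨ζ, hζ, hyz⟩ := TemperleyLieb.exists_leftInverse_y (δ := δ) hm.1 fun h0 => by
    subst h0
    exact TemperleyLieb.pow_ne_zero_of_zero_mem_Lam0 hm
  exact TemperleyLieb.exists_homEquiv hm.1 ζ hζ hyz
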